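/- Let $m,n,s$ be positive integers, let $X\in\mathbb{R}^{m\times n}$ be a nonzero matrix, and let $\varepsilon>0$, $\delta>0$ and $\beta\in(0,1]$ be real numbers. Write $\|X\|_F$ for the Frobenius norm, $\|X\|_2$ for the spectral norm, and $\mathrm{sr}(X)=\|X\|_F^2/\|X\|_2^2$ for the stable rank of $X$, and suppose that $\mathrm{sr}(X)\ge\varepsilon^2$. Let $p_{ij}\ge 0$ $(1\le i\le m,\ 1\le j\le n)$ satisfy $\sum_{i,j}p_{ij}=1$ and $$p_{ij}\ \ge\ \frac{\beta}{2}\left(\frac{X_{ij}^2}{\|X\|_F^2}+\frac{|X_{ij}|}{\sum_{k,l}|X_{kl}|}\right)\qquad\text{for all } i,j.$$ Let $(i_1,j_1),\dots,(i_s,j_s)$ be independent random index pairs with $\mathbb{P}[(i_t,j_t)=(i,j)]=p_{ij}$ for all $t,i,j$, and put $$S_\Omega(X)=\frac1s\sum_{t=1}^{s}\frac{X_{i_tj_t}}{p_{i_tj_t}}\,e_{i_t}e_{j_t}^{T},$$ where $e_i$ denotes a standard basis vector. If $$s\ \ge\ \frac{6\max\{m,n\}\,\ln\!\big((m+n)/\delta\big)}{\beta\varepsilon^2}\,\mathrm{sr}(X),$$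 then, with probability at least $1-\delta$, $$\|X-S_\Omega(X)\|_2\le\varepsilon\|X\|_2 .$$ -/

import Mathlib

open MeasureTheory ProbabilityTheory

namespace ElementSampling

section SpectralNorm

open scoped Matrix.Norms.L2Operator

/-- The spectral norm `‖X‖₂` of a real matrix: the operator norm between Euclidean spaces. -/
noncomputable def specNorm {m n : ℕ} (X : Matrix (Fin m) (Fin n) ℝ) : ℝ := ‖X‖

end SpectralNorm

section FrobeniusNorm

open scoped Matrix.Norms.Frobenius

/-- The Frobenius norm `‖X‖_F` of a real matrix. -/
noncomputable def frobNorm {m n : ℕ} (X : Matrix (Fin m) (Fin n) ℝ) : ℝ := ‖X‖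

theorem frobNorm_sq {m n : ℕ} (X : Matrix (Fin m) (Fin n) ℝ) :
    frobNorm X ^ 2 = ∑ i, ∑ j, X i j ^ 2 := by
  have h : 0 ≤ ∑ i, ∑ j, X i j ^ 2 :=
    Finset.sum_nonneg fun i _ => Finset.sum_nonneg fun j _ => sq_nonneg _
  simp only [frobNorm, Matrix.frobenius_norm_def, Real.norm_eq_abs, Real.rpow_two, sq_abs]
  rw [← Real.sqrt_eq_rpow, Real.sq_sqrt h]

end FrobeniusNorm

/-- The stable rank `‖X‖_F² / ‖X‖₂²` (it takes the value `0` at the zero matrix, so the condition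
`ε ^ 2 ≤ stableRank X` with `0 < ε` forces `X ≠ 0`). -/
noncomputable def stableRank {m n : ℕ} (X : Matrix (Fin m) (Fin n) ℝ) : ℝ :=
  frobNorm X ^ 2 / specNorm X ^ 2

/-- `p` is a probability distribution on the positions of an `m × n` matrix. -/
structure IsProbDistribution {m n : ℕ} (p : Fin m → Fin n → ℝ) : Prop where
  nonneg : ∀ i j, 0 ≤ p i j
  sum_eq_one : ∑ i, ∑ j, p i j = 1

/-- The lower bound on the sampling probabilities, with parameter `β`. -/
def SatisfiesBound {m n : ℕ} (X : Matrix (Fin m) (Fin n) ℝ) (β : ℝ) (p : Fin m → Fin n → ℝ) :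
    Prop :=
  ∀ i j, β / 2 * (X i j ^ 2 / frobNorm X ^ 2 + |X i j| / ∑ k, ∑ l, |X k l|) ≤ p i j

/-- The random positions `idx 0, …, idx (s - 1)` are drawn in `s` independent, identically
distributed trials, each of them equal to `(i, j)` with probability `p i j`. -/
structure IsIIDSample {Ω : Type*} [MeasurableSpace Ω] (μ : Measure Ω) {m n s : ℕ}
    (p : Fin m → Fin n → ℝ) (idx : Fin s → Ω → Fin m × Fin n) : Prop where
  measurable : ∀ t, Measurable (idx t)
  indep : iIndepFun idx μ
  law : ∀ t i j, μ.real {ω | idx t ω = (i, j)} = p i j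

/-- The sampling operator `S(X) = (1/s) ∑ₜ (X_{iₜ jₜ} / p_{iₜ jₜ}) e_{iₜ} e_{jₜ}ᵀ` attached to a
list of positions. -/
noncomputable def sketch {m n s : ℕ} (p : Fin m → Fin n → ℝ) (pos : Fin s → Fin m × Fin n)
    (X : Matrix (Fin m) (Fin n) ℝ) : Matrix (Fin m) (Fin n) ℝ :=
  (1 / (s : ℝ)) • ∑ t, Matrix.single (pos t).1 (pos t).2
    (X (pos t).1 (pos t).2 / p (pos t).1 (pos t).2)

end ElementSampling

/-!
The differences `X - R` between `X` and one rescaled draw `R = (X i j / p i j) eᵢ eⱼᵀ` are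
independent and centred, and their average is `X - S(X)`. The claim is therefore a matrix Bernstein inequality,
with the two bounds on `p i j` controlling its parameters. Write `M = max m n`.

* *Second moments.* `p i j ≥ (β / 2) X i j ^ 2 / ‖X‖_F ^ 2` makes every `X i j ^ 2 / p i j` at most
  `2 ‖X‖_F ^ 2 / β`, so the row and column second moments of `X - R` are at most
  `v = 2 M ‖X‖_F ^ 2 / β`.
* *Size.* `p i j ≥ (β / 2) |X i j| / ∑ |X k l|` and `∑ |X k l| ≤ M ‖X‖_F` give
  `‖X - R‖₂ ≤ L = 2 M ‖X‖_F / β + ‖X‖₂`.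

With `T = ε ‖X‖₂ ≤ ‖X‖_F`, which is the hypothesis on the stable rank, `v + L T / 3` is at most
`3 M ‖X‖_F ^ 2 / β`, and the Bernstein tail `(m + n) exp (- s T ^ 2 / (2 (v + L T / 3)))` is at most
`δ` for the stated sample size.

The Bernstein inequality `matrixBernstein` follows from its symmetric version
`matrixBernstein_symm` by passing to the dilation `[[0, Y], [Yᵀ, 0]]`, and the symmetric version is
proved by the Ahlswede–Winter argument: Markov's inequality is applied to `tr exp (θ ∑ D)`, and the
Golden–Thompson inequality `trace_exp_add_le` removes the independent summands one at a time
(`sum_prod_mul_trace_exp_le`), each of them costing a factor that bounds the largest eigenvalue of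
`E exp (θ D)`. For identically distributed summands this loses nothing compared with the sharper
approach through Lieb's concavity theorem.

Golden–Thompson is obtained from the trace inequality
`tr (A B) ^ 2 ^ k ≤ tr A ^ 2 ^ k B ^ 2 ^ k` for symmetric `A` and `B`, a consequence of iterated
Cauchy–Schwarz, applied to `exp (A / 2 ^ k)` and `exp (B / 2 ^ k)`; the Lie–Trotter formula
`tendsto_exp_mul_exp_pow` gives the limit `k → ∞`.

All expectations are finite sums: a sample is a point `pos` of `Fin s → α`, of weight
`∏ t, p (pos t)`.
-/

namespace ElementSampling
open Matrix NormedSpace Filter Topology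

/-! ### The Golden–Thompson inequality -/

section GoldenThompson
variable {ι : Type*} [Fintype ι] [DecidableEq ι]

theorem trace_mul_pow_comm (A B : Matrix ι ι ℝ) (k : ℕ) :
    trace ((A * B) ^ k) = trace ((B * A) ^ k) := by
  cases k with
  | zero => simp
  | succ k =>
    have h : ∀ k : ℕ, (A * B) ^ k * A = A * (B * A) ^ k := fun k => by
      induction k with
      | zero => simp
      | succ k ih => rw [pow_succ', mul_assoc, ih, pow_succ']; simp only [mul_assoc]
    rw [pow_succ, ← mul_assoc, h, mul_assoc, trace_mul_comm, mul_assoc, ← pow_succ]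

omit [DecidableEq ι] in
theorem trace_mul_sq_le (P Q : Matrix ι ι ℝ) :
    trace (P * Q) ^ 2 ≤ trace (Pᵀ * P) * trace (Qᵀ * Q) := by
  have h := Finset.sum_mul_sq_le_sq_mul_sq (Finset.univ : Finset (ι × ι))
    (fun x => P x.1 x.2) (fun x => Q x.2 x.1)
  have e1 : trace (P * Q) = ∑ x : ι × ι, P x.1 x.2 * Q x.2 x.1 := by
    simp [trace, mul_apply, Fintype.sum_prod_type]
  have e2 : trace (Pᵀ * P) = ∑ x : ι × ι, P x.1 x.2 ^ 2 := by
    simp only [trace, diag_apply, mul_apply, Fintype.sum_prod_type, transpose_apply, sq]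
    exact Finset.sum_comm
  have e3 : trace (Qᵀ * Q) = ∑ x : ι × ι, Q x.2 x.1 ^ 2 := by
    simp only [trace, diag_apply, mul_apply, Fintype.sum_prod_type, transpose_apply, sq]
  rw [e1, e2, e3]; exact h

/-- Cauchy–Schwarz iterated `k` times: a Hölder inequality for the Schatten norms of exponent
`2 ^ (k + 1)`. The step rewrites `(P * Q) ^ 2 ^ (k + 1)` as `((P * Q) * (P * Q)) ^ 2 ^ k` and
regroups `(P * Q)ᵀ * (P * Q)` cyclically as `(Pᵀ * P) * (Q * Qᵀ)`. -/
theorem trace_mul_pow_two_pow_sq_le (k : ℕ) (P Q : Matrix ι ι ℝ) :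
    trace ((P * Q) ^ 2 ^ k) ^ 2 ≤ trace ((Pᵀ * P) ^ 2 ^ k) * trace ((Qᵀ * Q) ^ 2 ^ k) := by
  induction k generalizing P Q with
  | zero => simpa using trace_mul_sq_le P Q
  | succ k ih =>
    have e : ∀ M : Matrix ι ι ℝ, M ^ 2 ^ (k + 1) = (M * M) ^ 2 ^ k := fun M => by
      rw [pow_succ', pow_mul, sq]
    have h1 := ih (P * Q) (P * Q)
    have h2 := ih (Pᵀ * P) (Q * Qᵀ)
    have e1 : trace (((P * Q)ᵀ * (P * Q)) ^ 2 ^ k) = trace ((Pᵀ * P * (Q * Qᵀ)) ^ 2 ^ k) := by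
      rw [transpose_mul, mul_assoc, trace_mul_pow_comm]
      simp only [mul_assoc]
    have e2 : trace ((Qᵀ * Q) ^ 2 ^ (k + 1)) = trace ((Q * Qᵀ) ^ 2 ^ (k + 1)) :=
      trace_mul_pow_comm _ _ _
    rw [e2, e, e, e]
    simp only [transpose_mul, transpose_transpose] at h1 h2 e1
    rw [e1, ← sq (trace _)] at h1
    exact h1.trans h2

/-- The previous inequality with `P = Q = A * B` turns `tr (A * B) ^ 2 ^ (k + 1)` into
`tr (A ^ 2 * B ^ 2) ^ 2 ^ k`, which is then iterated. -/
theorem trace_mul_pow_two_pow_le {A B : Matrix ι ι ℝ} (hA : A.IsSymm) (hB : B.IsSymm) (k : ℕ) :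
    trace ((A * B) ^ 2 ^ k) ≤ trace (A ^ 2 ^ k * B ^ 2 ^ k) := by
  induction k generalizing A B with
  | zero => simp
  | succ k ih =>
    have e : ∀ M : Matrix ι ι ℝ, M ^ 2 ^ (k + 1) = (M ^ 2) ^ 2 ^ k := fun M => by
      rw [pow_succ', pow_mul]
    have h := trace_mul_pow_two_pow_sq_le k (A * B) (A * B)
    have e1 : trace (((A * B)ᵀ * (A * B)) ^ 2 ^ k) = trace ((A ^ 2 * B ^ 2) ^ 2 ^ k) := by
      rw [transpose_mul, hA.eq, hB.eq, mul_assoc, trace_mul_pow_comm]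
      simp only [mul_assoc, sq]
    have h3 := ih (hA.pow 2) (hB.pow 2)
    have h0 : 0 ≤ trace (((A * B)ᵀ * (A * B)) ^ 2 ^ k) :=
      ((posSemidef_conjTranspose_mul_self (A * B)).pow _).trace_nonneg
    rw [e, e, e, sq (A * B)]
    rw [← sq (trace _)] at h
    exact (abs_le_of_sq_le_sq' h h0).2.trans (e1.le.trans h3)

theorem norm_pow_sub_pow_le {𝔸 : Type*} [NormedRing 𝔸] [NormOneClass 𝔸] {x y : 𝔸} {M : ℝ}
    (hM : 1 ≤ M) (hx : ‖x‖ ≤ M) (hy : ‖y‖ ≤ M) (k : ℕ) :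
    ‖x ^ k - y ^ k‖ ≤ k * M ^ k * ‖x - y‖ := by
  have hM0 : 0 ≤ M := zero_le_one.trans hM
  induction k with
  | zero => simp
  | succ k ih =>
    have e : x ^ (k + 1) - y ^ (k + 1) = x ^ k * (x - y) + (x ^ k - y ^ k) * y := by
      rw [pow_succ, pow_succ, mul_sub, sub_mul]; abel
    have h1 : ‖x ^ k * (x - y)‖ ≤ M ^ (k + 1) * ‖x - y‖ := by
      refine (norm_mul_le _ _).trans ?_
      gcongr
      refine (norm_pow_le _ _).trans ?_
      exact (pow_le_pow_left₀ (norm_nonneg _) hx k).trans (pow_le_pow_right₀ hM k.le_succ)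
    have h2 : ‖(x ^ k - y ^ k) * y‖ ≤ k * M ^ (k + 1) * ‖x - y‖ := by
      refine (norm_mul_le _ _).trans ?_
      calc ‖x ^ k - y ^ k‖ * ‖y‖ ≤ (k * M ^ k * ‖x - y‖) * M := by gcongr
        _ = k * M ^ (k + 1) * ‖x - y‖ := by ring
    rw [e]
    refine (norm_add_le _ _).trans ((add_le_add h1 h2).trans (le_of_eq ?_))
    push_cast; ring

/-- For two curves through `1` with the same velocity there, the `k`-th powers of the values at
`1 / k` have the same limiting behaviour: the values differ by `o(1 / k)`, and powers up to `k` of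
them stay bounded. -/
theorem tendsto_pow_sub_pow_of_hasDerivAt {𝔸 : Type*} [NormedRing 𝔸] [NormOneClass 𝔸]
    [NormedAlgebra ℝ 𝔸] {f g : ℝ → 𝔸} {v : 𝔸} (hf : HasDerivAt f v 0) (hg : HasDerivAt g v 0)
    (hf0 : f 0 = 1) (hg0 : g 0 = 1) :
    Tendsto (fun k : ℕ => f (k : ℝ)⁻¹ ^ k - g (k : ℝ)⁻¹ ^ k) atTop (𝓝 0) := by
  have hbound : ∀ {φ : ℝ → 𝔸}, HasDerivAt φ v 0 → φ 0 = 1 →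
      ∃ C, 0 < C ∧ ∀ᶠ t in 𝓝 (0 : ℝ), ‖φ t‖ ≤ 1 + C * |t| := by
    intro φ hφ hφ0
    obtain ⟨C, hC, h⟩ := hφ.isBigO_sub.exists_pos
    refine ⟨C, hC, h.bound.mono fun t ht => ?_⟩
    rw [hφ0, sub_zero, Real.norm_eq_abs] at ht
    calc ‖φ t‖ = ‖1 + (φ t - 1)‖ := by rw [add_sub_cancel]
      _ ≤ 1 + C * |t| := (norm_add_le _ _).trans (by rw [norm_one]; gcongr)
  obtain ⟨C, hC, hfC⟩ := hbound hf hf0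
  obtain ⟨C', hC', hgC⟩ := hbound hg hg0
  have hinv : Tendsto (fun k : ℕ => (k : ℝ)⁻¹) atTop (𝓝[≠] 0) :=
    (tendsto_inv_atTop_nhdsGT_zero.comp tendsto_natCast_atTop_atTop).mono_right
      (nhdsWithin_mono _ fun x (hx : 0 < x) => hx.ne')
  have hinv' : Tendsto (fun k : ℕ => (k : ℝ)⁻¹) atTop (𝓝 0) := hinv.mono_right nhdsWithin_le_nhds
  have hslope : Tendsto (fun k : ℕ => (k : ℝ) • (f (k : ℝ)⁻¹ - g (k : ℝ)⁻¹)) atTop (𝓝 0) := by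
    have := (hasDerivAt_iff_tendsto_slope_zero.1 (hf.sub hg)).comp hinv
    simpa [Function.comp_def, hf0, hg0] using this
  have hlim : Tendsto (fun k : ℕ => Real.exp (max C C') *
      ‖(k : ℝ) • (f (k : ℝ)⁻¹ - g (k : ℝ)⁻¹)‖) atTop (𝓝 0) := by
    simpa using hslope.norm.const_mul (Real.exp (max C C'))
  refine squeeze_zero_norm' ?_ hlim
  filter_upwards [hinv'.eventually hfC, hinv'.eventually hgC, eventually_gt_atTop 0]
    with k hk hk' hk0
  have hk1 : (0 : ℝ) < k := by exact_mod_cast hk0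
  have habs : |(k : ℝ)⁻¹| = (k : ℝ)⁻¹ := abs_of_pos (inv_pos.2 hk1)
  rw [habs] at hk hk'
  set M := 1 + max C C' * (k : ℝ)⁻¹ with hM
  have hM1 : 1 ≤ M := by rw [hM, le_add_iff_nonneg_right]; positivity
  have hMk : M ^ k ≤ Real.exp (max C C') := by
    calc M ^ k ≤ Real.exp (max C C' * (k : ℝ)⁻¹) ^ k := by
          refine pow_le_pow_left₀ (zero_le_one.trans hM1) ?_ k
          rw [hM, add_comm]; exact Real.add_one_le_exp _
      _ = Real.exp (max C C') := by rw [← Real.exp_nat_mul]; congr 1; field_simp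
  have h := norm_pow_sub_pow_le hM1 (hk.trans (by rw [hM]; gcongr; exact le_max_left _ _))
    (hk'.trans (by rw [hM]; gcongr; exact le_max_right _ _)) k
  refine h.trans ?_
  rw [norm_smul, Real.norm_eq_abs, abs_of_pos hk1]
  calc _ = M ^ k * (k * ‖f (k : ℝ)⁻¹ - g (k : ℝ)⁻¹‖) := by ring
    _ ≤ _ := by gcongr

/-- The **Lie–Trotter product formula**. -/
theorem tendsto_exp_mul_exp_pow {𝔸 : Type*} [NormedRing 𝔸] [NormOneClass 𝔸] [NormedAlgebra ℝ 𝔸]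
    [CompleteSpace 𝔸] (a b : 𝔸) :
    Tendsto (fun k : ℕ => (exp ((k : ℝ)⁻¹ • a) * exp ((k : ℝ)⁻¹ • b)) ^ k) atTop
      (𝓝 (exp (a + b))) := by
  have hd : ∀ x : 𝔸, HasDerivAt (fun u : ℝ => exp (u • x)) x 0 := fun x => by
    simpa using hasDerivAt_exp_smul_const x (0 : ℝ)
  have hab : HasDerivAt (fun u : ℝ => exp (u • a) * exp (u • b)) (a + b) 0 := by
    have h := (hd a).mul (hd b)
    simp only [zero_smul, exp_zero, one_mul, mul_one] at h
    exact h
  have h := tendsto_pow_sub_pow_of_hasDerivAt hab (hd (a + b)) (by simp) (by simp)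
  have h' := h.add_const (exp (a + b))
  rw [zero_add] at h'
  refine h'.congr' ?_
  filter_upwards [eventually_gt_atTop 0] with k hk
  let _ : NormedAlgebra ℚ 𝔸 := NormedAlgebra.restrictScalars ℚ ℝ 𝔸
  have hk1 : (k : ℝ) ≠ 0 := by exact_mod_cast hk.ne'
  rw [← NormedSpace.exp_nsmul, ← Nat.cast_smul_eq_nsmul ℝ, smul_smul, mul_inv_cancel₀ hk1, one_smul,
    sub_add_cancel]

open scoped Matrix.Norms.Operator in
/-- The **Golden–Thompson inequality** for real symmetric matrices. -/
theorem trace_exp_add_le {A B : Matrix ι ι ℝ} (hA : A.IsSymm) (hB : B.IsSymm) :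
    trace (exp (A + B)) ≤ trace (exp A * exp B) := by
  cases isEmpty_or_nonempty ι
  · simp [trace]
  have h := (tendsto_exp_mul_exp_pow A B).comp (tendsto_pow_atTop_atTop_of_one_lt one_lt_two)
  have h' : Tendsto _ _ _ := ((continuous_id.matrix_trace).tendsto (exp (A + B))).comp h
  refine le_of_tendsto h' (Eventually.of_forall fun k => ?_)
  have hpow : ∀ C : Matrix ι ι ℝ, exp (((2 ^ k : ℕ) : ℝ)⁻¹ • C) ^ 2 ^ k = exp C := fun C => by
    have hk1 : ((2 ^ k : ℕ) : ℝ) ≠ 0 := by positivity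
    rw [← Matrix.exp_nsmul, ← Nat.cast_smul_eq_nsmul ℝ, smul_smul, mul_inv_cancel₀ hk1, one_smul]
  have := trace_mul_pow_two_pow_le (hA.smul ((2 ^ k : ℕ) : ℝ)⁻¹).exp
    (hB.smul ((2 ^ k : ℕ) : ℝ)⁻¹).exp k
  rw [hpow, hpow] at this
  exact this

end GoldenThompson

/-! ### A Bernstein inequality for symmetric matrices -/

section Bernstein
variable {ι : Type*} [Fintype ι] [DecidableEq ι]

/-- The Padé bound `exp x ≤ (6 + 4 x + x ^ 2) / (6 - 2 x)`, in a form that holds for all real `x`.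
Multiplied by `exp (-x)`, the difference of the two sides is convex with a double zero at `0`. -/
theorem exp_mul_le_quadratic (x : ℝ) : Real.exp x * (6 - 2 * x) ≤ 6 + 4 * x + x ^ 2 := by
  have hk1 : ∀ y : ℝ, HasDerivAt (fun y : ℝ => Real.exp (-y) * (6 + 4 * y + y ^ 2) - 6 + 2 * y)
      (2 - Real.exp (-y) * (y ^ 2 + 2 * y + 2)) y := fun y => by
    have he := (hasDerivAt_neg y).exp
    have hq := (((hasDerivAt_id y).const_mul 4).const_add 6).add ((hasDerivAt_id y).pow 2)
    refine (((he.mul hq).sub_const 6).add ((hasDerivAt_id y).const_mul 2)).congr_deriv ?_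
    simp; ring
  have hk2 : ∀ y : ℝ, HasDerivAt (fun y : ℝ => 2 - Real.exp (-y) * (y ^ 2 + 2 * y + 2))
      (Real.exp (-y) * y ^ 2) y := fun y => by
    have he := (hasDerivAt_neg y).exp
    have hq := (((hasDerivAt_id y).pow 2).add ((hasDerivAt_id y).const_mul 2)).add_const 2
    refine ((he.mul hq).const_sub 2).congr_deriv ?_
    simp; ring
  have hmono : Monotone fun y : ℝ => 2 - Real.exp (-y) * (y ^ 2 + 2 * y + 2) :=
    monotone_of_deriv_nonneg (fun y => (hk2 y).differentiableAt) fun y => by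
      rw [(hk2 y).deriv]; positivity
  have hk : 0 ≤ Real.exp (-x) * (6 + 4 * x + x ^ 2) - 6 + 2 * x := by
    rcases le_total 0 x with hx | hx
    · have := monotoneOn_of_deriv_nonneg (convex_Ici (0 : ℝ))
        (fun y _ => (hk1 y).continuousAt.continuousWithinAt)
        (fun y _ => (hk1 y).differentiableAt.differentiableWithinAt) (fun y hy => by
          rw [interior_Ici] at hy
          rw [(hk1 y).deriv]
          simpa using hmono (le_of_lt hy)) Set.self_mem_Ici hx hx
      simpa using this
    · have := antitoneOn_of_deriv_nonpos (convex_Iic (0 : ℝ))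
        (fun y _ => (hk1 y).continuousAt.continuousWithinAt)
        (fun y _ => (hk1 y).differentiableAt.differentiableWithinAt) (fun y hy => by
          rw [interior_Iic] at hy
          rw [(hk1 y).deriv]
          simpa using hmono (le_of_lt hy)) hx Set.self_mem_Iic hx
      simpa using this
  have h := mul_nonneg (Real.exp_pos x).le hk
  have e : Real.exp x * Real.exp (-x) = 1 := by rw [← Real.exp_add, add_neg_cancel, Real.exp_zero]
  linear_combination h + (6 + 4 * x + x ^ 2) * e

/-- The scalar inequality behind Bernstein's bound on the moment generating function. -/
theorem exp_le_one_add_add_sq {x L : ℝ} (hxL : x ≤ L) (hL : L < 3) :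
    Real.exp x ≤ 1 + x + 1 / (2 * (1 - L / 3)) * x ^ 2 := by
  have h1 : 0 < 6 - 2 * L := by linarith
  have h2 : 0 < 6 - 2 * x := by linarith
  have h2' : 6 - 2 * x ≠ 0 := h2.ne'
  have h1' : 3 - L ≠ 0 := by linarith
  calc Real.exp x ≤ (6 + 4 * x + x ^ 2) / (6 - 2 * x) := (le_div_iff₀ h2).2 (exp_mul_le_quadratic x)
    _ = 1 + x + 3 / (6 - 2 * x) * x ^ 2 := by
        rw [div_eq_iff h2', add_mul, div_mul_eq_mul_div, div_mul_cancel₀ _ h2']; ring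
    _ ≤ 1 + x + 3 / (6 - 2 * L) * x ^ 2 := by gcongr
    _ = _ := by
        rw [show 6 - 2 * L = 3 * (2 * (1 - L / 3)) by ring, ← div_div, div_self three_ne_zero]

theorem exists_orthogonal_diagonalization {A : Matrix ι ι ℝ} (hA : A.IsSymm) :
    ∃ (U : Matrix ι ι ℝ) (d : ι → ℝ), IsUnit U ∧ U * Uᵀ = 1 ∧ Uᵀ * U = 1 ∧
      A = U * diagonal d * Uᵀ ∧ exp A = U * diagonal (fun i => Real.exp (d i)) * Uᵀ := by
  have hH : A.IsHermitian := hA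
  have h1 : (hH.eigenvectorUnitary : Matrix ι ι ℝ) * (hH.eigenvectorUnitary : Matrix ι ι ℝ)ᵀ = 1 :=
    Unitary.coe_mul_star_self hH.eigenvectorUnitary
  have h2 : (hH.eigenvectorUnitary : Matrix ι ι ℝ)ᵀ * (hH.eigenvectorUnitary : Matrix ι ι ℝ) = 1 :=
    Unitary.coe_star_mul_self hH.eigenvectorUnitary
  have h3 : A = (hH.eigenvectorUnitary : Matrix ι ι ℝ) * diagonal hH.eigenvalues *
      (hH.eigenvectorUnitary : Matrix ι ι ℝ)ᵀ := hH.spectral_theorem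
  generalize (hH.eigenvectorUnitary : Matrix ι ι ℝ) = U at h1 h2 h3
  have hU : IsUnit U := IsUnit.of_mul_eq_one _ h1
  refine ⟨U, hH.eigenvalues, hU, h1, h2, h3, ?_⟩
  have hinv : Uᵀ = U⁻¹ := (inv_eq_right_inv h1).symm
  conv_lhs => rw [h3, hinv, Matrix.exp_conj _ _ hU, Matrix.exp_diagonal, ← hinv]
  congr 3
  ext i
  rw [Pi.exp_def, Real.exp_eq_exp_ℝ]

theorem posSemidef_conj_diagonal_iff {U : Matrix ι ι ℝ} (hU : IsUnit U) (d : ι → ℝ) :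
    (U * diagonal d * Uᵀ).PosSemidef ↔ ∀ i, 0 ≤ d i := by
  rw [← posSemidef_diagonal_iff]
  exact hU.posSemidef_star_right_conjugate_iff

theorem posSemidef_exp {A : Matrix ι ι ℝ} (hA : A.IsSymm) : (exp A).PosSemidef := by
  obtain ⟨U, d, hU, -, -, -, h⟩ := exists_orthogonal_diagonalization hA
  rw [h, posSemidef_conj_diagonal_iff hU]
  exact fun i => (Real.exp_pos _).le

omit [DecidableEq ι] in
theorem trace_mul_nonneg {P Q : Matrix ι ι ℝ} (hP : P.PosSemidef) (hQ : Q.PosSemidef) :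
    0 ≤ trace (P * Q) := by
  classical
  obtain ⟨B, rfl⟩ : ∃ B : Matrix ι ι ℝ, P = Bᴴ * B := by
    open scoped MatrixOrder in exact CStarAlgebra.nonneg_iff_eq_star_mul_self.1 hP.nonneg
  rw [mul_assoc, trace_mul_comm]
  exact (hQ.mul_mul_conjTranspose_same B).trace_nonneg

theorem smul_one_sub_eq_conj {U : Matrix ι ι ℝ} {d : ι → ℝ} (h : U * Uᵀ = 1) (L : ℝ) :
    L • 1 - U * diagonal d * Uᵀ = U * diagonal (fun i => L - d i) * Uᵀ := by
  have : diagonal (fun i => L - d i) = L • (1 : Matrix ι ι ℝ) - diagonal d := by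
    ext i j; by_cases hij : i = j <;> simp [hij, diagonal, one_apply]
  rw [this, mul_sub, sub_mul, mul_smul_comm, mul_one, smul_mul_assoc, h]

/-- The Loewner-order version of `exp_le_one_add_add_sq`. -/
theorem posSemidef_quadratic_sub_exp {A : Matrix ι ι ℝ} (hA : A.IsSymm) {L : ℝ} (hL : L < 3)
    (hAL : (L • 1 - A).PosSemidef) :
    (1 + A + (1 / (2 * (1 - L / 3))) • (A * A) - exp A).PosSemidef := by
  obtain ⟨U, d, hU, h1, h2, h3, h4⟩ := exists_orthogonal_diagonalization hA
  rw [h3, smul_one_sub_eq_conj h1, posSemidef_conj_diagonal_iff hU] at hAL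
  have key : 1 + A + (1 / (2 * (1 - L / 3))) • (A * A) - exp A = U * diagonal (fun i =>
      1 + d i + 1 / (2 * (1 - L / 3)) * d i ^ 2 - Real.exp (d i)) * Uᵀ := by
    have hAA : A * A = U * diagonal (fun i => d i ^ 2) * Uᵀ := by
      have : (fun i => d i ^ 2) = fun i => d i * d i := by ext i; ring
      rw [this, ← diagonal_mul_diagonal, h3]
      calc _ = U * diagonal d * (Uᵀ * U) * diagonal d * Uᵀ := by simp only [mul_assoc]
        _ = _ := by rw [h2]; simp only [mul_assoc, one_mul]
    rw [h4, hAA]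
    conv_lhs => rw [h3, ← h1]
    have e : diagonal (fun i => 1 + d i + 1 / (2 * (1 - L / 3)) * d i ^ 2 - Real.exp (d i)) =
        1 + diagonal d + (1 / (2 * (1 - L / 3))) • diagonal (fun i => d i ^ 2) -
          diagonal (fun i => Real.exp (d i)) := by
      ext i j; by_cases hij : i = j <;> simp [hij, diagonal, one_apply]
    rw [e]
    simp only [mul_add, add_mul, mul_sub, sub_mul, mul_one, mul_smul_comm, smul_mul_assoc]
  rw [key, posSemidef_conj_diagonal_iff hU]
  intro i
  have := exp_le_one_add_add_sq (sub_nonneg.1 (hAL i)) hL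
  linarith

/-- If some eigenvalue of `A` exceeds `T`, it alone makes the trace of `exp A` at least `exp T`. -/
theorem exp_le_trace_exp {A : Matrix ι ι ℝ} (hA : A.IsSymm) {T : ℝ}
    (hT : ¬ (T • 1 - A).PosSemidef) : Real.exp T ≤ trace (exp A) := by
  obtain ⟨U, d, hU, h1, h2, h3, h4⟩ := exists_orthogonal_diagonalization hA
  rw [h3, smul_one_sub_eq_conj h1, posSemidef_conj_diagonal_iff hU] at hT
  push Not at hT
  obtain ⟨i, hi⟩ := hT
  rw [h4, trace_mul_cycle, h2, one_mul, trace_diagonal]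
  refine (Real.exp_le_exp.2 (sub_neg.1 hi).le).trans ?_
  exact Finset.single_le_sum (f := fun i => Real.exp (d i)) (fun i _ => (Real.exp_pos _).le)
    (Finset.mem_univ i)

variable {α : Type*} [Fintype α]

omit [Fintype ι] [DecidableEq ι] in
theorem isSymm_sum {κ : Type*} (s : Finset κ) {D : κ → Matrix ι ι ℝ} (hD : ∀ a, (D a).IsSymm) :
    (∑ a ∈ s, D a).IsSymm := by
  rw [IsSymm, transpose_sum]
  exact Finset.sum_congr rfl fun a _ => hD a

/-- If `E exp D ≤ c • 1`, then `E tr exp (D₁ + ⋯ + Dₛ) ≤ c ^ s * tr 1` for independent copies of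
`D`: by Golden–Thompson, averaging over one summand costs a factor `c`. -/
theorem sum_prod_mul_trace_exp_le {p : α → ℝ} (hp : ∀ a, 0 ≤ p a) {D : α → Matrix ι ι ℝ}
    (hD : ∀ a, (D a).IsSymm) {c : ℝ} (hc : 0 ≤ c)
    (hK : (c • 1 - ∑ a, p a • exp (D a)).PosSemidef) (s : ℕ) :
    ∑ pos : Fin s → α, (∏ t, p (pos t)) * trace (exp (∑ t, D (pos t))) ≤
      c ^ s * Fintype.card ι := by
  induction s with
  | zero => simp
  | succ s ih =>
    have hstep : ∀ B : Matrix ι ι ℝ, B.IsSymm →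
        ∑ a, p a * trace (exp (D a + B)) ≤ c * trace (exp B) := by
      intro B hB
      calc ∑ a, p a * trace (exp (D a + B)) ≤ ∑ a, p a * trace (exp B * exp (D a)) := by
            refine Finset.sum_le_sum fun a _ => mul_le_mul_of_nonneg_left ?_ (hp a)
            rw [add_comm]; exact trace_exp_add_le hB (hD a)
        _ = trace (exp B * ∑ a, p a • exp (D a)) := by
            simp [Finset.mul_sum, trace_sum]
        _ ≤ c * trace (exp B) := by
            have := trace_mul_nonneg (posSemidef_exp hB) hK
            rw [mul_sub, trace_sub, mul_smul_comm, mul_one, trace_smul, smul_eq_mul] at this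
            linarith
    rw [← (Fin.consEquiv fun _ => α).sum_comp, Fintype.sum_prod_type_right]
    calc _ = ∑ pos : Fin s → α, (∏ t, p (pos t)) *
          ∑ a, p a * trace (exp (D a + ∑ t, D (pos t))) := by
          refine Finset.sum_congr rfl fun pos _ => ?_
          rw [Finset.mul_sum]
          refine Finset.sum_congr rfl fun a _ => ?_
          simp [Fin.consEquiv, Fin.prod_univ_succ, Fin.sum_univ_succ]
          ring
      _ ≤ ∑ pos : Fin s → α, (∏ t, p (pos t)) * (c * trace (exp (∑ t, D (pos t)))) :=
          Finset.sum_le_sum fun pos _ => mul_le_mul_of_nonneg_left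
            (hstep _ (isSymm_sum _ fun t => hD _)) (Finset.prod_nonneg fun t _ => hp _)
      _ = c * ∑ pos : Fin s → α, (∏ t, p (pos t)) * trace (exp (∑ t, D (pos t))) := by
          rw [Finset.mul_sum]; exact Finset.sum_congr rfl fun _ _ => by ring
      _ ≤ c * (c ^ s * Fintype.card ι) := by gcongr
      _ = _ := by ring

open Classical in
/-- The **matrix Bernstein inequality** for `s` independent copies of a centred random symmetric
matrix `D` with `D ≤ L • 1` and `E (D * D) ≤ v • 1`. The event that the largest eigenvalue of the
sum exceeds `s * T` is written in the Loewner order. -/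
theorem matrixBernstein_symm {p : α → ℝ} (hp : ∀ a, 0 ≤ p a) (hp1 : ∑ a, p a = 1)
    {D : α → Matrix ι ι ℝ} (hD : ∀ a, (D a).IsSymm) (hmean : ∑ a, p a • D a = 0)
    {L v T : ℝ} (hL : 0 ≤ L) (hv : 0 < v) (hT : 0 < T)
    (hDL : ∀ a, (L • 1 - D a).PosSemidef)
    (hvar : (v • 1 - ∑ a, p a • (D a * D a)).PosSemidef) (s : ℕ) :
    ∑ pos : Fin s → α with ¬ ((s * T) • 1 - ∑ t, D (pos t)).PosSemidef, ∏ t, p (pos t) ≤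
      Fintype.card ι * Real.exp (-(s * (T ^ 2 / (2 * (v + L * T / 3))))) := by
  have hden : 0 < v + L * T / 3 := by positivity
  -- This choice of `θ` makes the bound `g * θ ^ 2 * v` on the logarithmic moment generating
  -- function equal to `θ * T / 2`, half of what Markov's inequality gains.
  set θ := T / (v + L * T / 3) with hθ
  have hθ0 : 0 < θ := by positivity
  have hratio : 1 - θ * L / 3 = v / (v + L * T / 3) := by rw [hθ]; field_simp; ring
  have hθL : θ * L < 3 := by
    have : 0 < 1 - θ * L / 3 := by rw [hratio]; positivity
    linarith
  set g := 1 / (2 * (1 - θ * L / 3)) with hg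
  have hg0 : 0 ≤ g := by rw [hg, hratio]; positivity
  have hgv : g * θ ^ 2 * v = θ * T / 2 := by
    rw [hg, hratio, hθ]; field_simp
  set c := Real.exp (θ * T / 2) with hc
  have hsymm : ∀ a, (θ • D a).IsSymm := fun a => (hD a).smul θ
  have hK : (c • 1 - ∑ a, p a • exp (θ • D a)).PosSemidef := by
    have h1 : (∑ a, p a • (1 + θ • D a + g • (θ • D a * θ • D a) - exp (θ • D a))).PosSemidef := by
      refine posSemidef_sum _ fun a _ => PosSemidef.smul ?_ (hp a)
      refine posSemidef_quadratic_sub_exp (hsymm a) hθL ?_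
      have := (hDL a).smul hθ0.le
      rwa [smul_sub, smul_smul] at this
    have h2 : ((g * θ ^ 2) • (v • 1 - ∑ a, p a • (D a * D a))).PosSemidef :=
      hvar.smul (by positivity)
    have h3 : ((c - (1 + θ * T / 2)) • (1 : Matrix ι ι ℝ)).PosSemidef :=
      PosSemidef.one.smul (by rw [hc]; linarith [Real.add_one_le_exp (θ * T / 2)])
    -- `E exp (θ D) ≤ 1 + g θ² E D² ≤ (1 + θ T / 2) • 1 ≤ c • 1`;
    -- the three gaps are `h1`, `h2`, `h3`.
    convert (h1.add h2).add h3 using 1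
    have e : ∑ a, p a • (1 + θ • D a + g • (θ • D a * θ • D a) - exp (θ • D a)) =
        1 + (g * θ ^ 2) • ∑ a, p a • (D a * D a) - ∑ a, p a • exp (θ • D a) := by
      have e1 : ∑ a, p a • (1 : Matrix ι ι ℝ) = 1 := by rw [← Finset.sum_smul, hp1, one_smul]
      have e2 : ∑ a, p a • θ • D a = 0 := by
        simp_rw [smul_comm _ θ]; rw [← Finset.smul_sum, hmean, smul_zero]
      have e3 : ∑ a, p a • g • (θ • D a * θ • D a) = (g * θ ^ 2) • ∑ a, p a • (D a * D a) := by
        rw [Finset.smul_sum]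
        refine Finset.sum_congr rfl fun a _ => ?_
        rw [smul_mul_smul_comm, smul_smul, smul_smul, smul_smul]
        congr 1; ring
      simp only [smul_sub, smul_add, Finset.sum_sub_distrib, Finset.sum_add_distrib, e1, e2, e3,
        add_zero]
    rw [e, smul_sub, smul_smul, hgv, sub_smul, add_smul, one_smul]
    abel
  have hmgf := sum_prod_mul_trace_exp_le hp hsymm (Real.exp_pos _).le hK s
  -- Markov's inequality for `tr exp (θ ∑ D)`.
  have hmarkov : Real.exp (θ * (s * T)) *
      ∑ pos : Fin s → α with ¬ ((s * T) • 1 - ∑ t, D (pos t)).PosSemidef, ∏ t, p (pos t) ≤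
      ∑ pos : Fin s → α, (∏ t, p (pos t)) * trace (exp (∑ t, θ • D (pos t))) := by
    rw [Finset.mul_sum, Finset.sum_filter]
    refine Finset.sum_le_sum fun pos _ => ?_
    have hw : 0 ≤ ∏ t, p (pos t) := Finset.prod_nonneg fun t _ => hp _
    have hS : (∑ t, θ • D (pos t)).IsSymm := isSymm_sum _ fun t => hsymm _
    by_cases h : ((s * T) • 1 - ∑ t, D (pos t)).PosSemidef
    · rw [if_neg (not_not.2 h)]
      exact mul_nonneg hw (posSemidef_exp hS).trace_nonneg
    · rw [if_pos h, mul_comm]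
      refine mul_le_mul_of_nonneg_left (exp_le_trace_exp hS fun hps => h ?_) hw
      have := hps.smul (inv_pos.2 hθ0).le
      rwa [← Finset.smul_sum, smul_sub, smul_smul, smul_smul, inv_mul_cancel_left₀ hθ0.ne',
        inv_mul_cancel₀ hθ0.ne', one_smul] at this
  have hfin := hmarkov.trans hmgf
  rw [← le_div_iff₀' (Real.exp_pos _)] at hfin
  refine hfin.trans (le_of_eq ?_)
  rw [← Real.exp_nat_mul, mul_comm, mul_div_assoc, ← Real.exp_sub]
  congr 2
  rw [hθ]; field_simp; ring

end Bernstein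

/-! ### Dilations and the Bernstein inequality for rectangular matrices -/

section Rectangular
variable {m n : ℕ}

/-- The symmetric dilation `[[0, Y], [Yᵀ, 0]]` of a rectangular matrix, as a linear map. Its largest
eigenvalue is the spectral norm of `Y`. -/
noncomputable def dilation :
    Matrix (Fin m) (Fin n) ℝ →ₗ[ℝ] Matrix (Fin m ⊕ Fin n) (Fin m ⊕ Fin n) ℝ where
  toFun Y := fromBlocks 0 Y Yᵀ 0
  map_add' Y Z := by simp [fromBlocks_add]
  map_smul' c Y := by simp [fromBlocks_smul]

theorem dilation_apply (Y : Matrix (Fin m) (Fin n) ℝ) : dilation Y = fromBlocks 0 Y Yᵀ 0 := rfl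

theorem dilation_isSymm (Y : Matrix (Fin m) (Fin n) ℝ) : (dilation Y).IsSymm := by
  simp [dilation_apply, IsSymm, fromBlocks_transpose]

theorem dilation_mulVec (Y : Matrix (Fin m) (Fin n) ℝ) (u : Fin m → ℝ) (w : Fin n → ℝ) :
    dilation Y *ᵥ Sum.elim u w = Sum.elim (Y *ᵥ w) (Yᵀ *ᵥ u) := by
  simp [dilation_apply, fromBlocks_mulVec]

theorem dotProduct_dilation_mulVec (Y : Matrix (Fin m) (Fin n) ℝ) (u : Fin m → ℝ)
    (w : Fin n → ℝ) :
    Sum.elim u w ⬝ᵥ (dilation Y *ᵥ Sum.elim u w) = 2 * (u ⬝ᵥ Y *ᵥ w) := by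
  rw [dilation_mulVec, sumElim_dotProduct_sumElim, mulVec_transpose, dotProduct_comm w,
    ← dotProduct_mulVec]
  ring

theorem specNorm_nonneg (Y : Matrix (Fin m) (Fin n) ℝ) : 0 ≤ specNorm Y := by
  open scoped Matrix.Norms.L2Operator in exact norm_nonneg Y

theorem specNorm_smul (c : ℝ) (Y : Matrix (Fin m) (Fin n) ℝ) :
    specNorm (c • Y) = |c| * specNorm Y := by
  open scoped Matrix.Norms.L2Operator in exact norm_smul c Y

theorem specNorm_sub_le (Y Z : Matrix (Fin m) (Fin n) ℝ) :
    specNorm (Y - Z) ≤ specNorm Y + specNorm Z := by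
  open scoped Matrix.Norms.L2Operator in exact norm_sub_le Y Z

theorem norm_toLp_sq {k : ℕ} (v : Fin k → ℝ) : ‖WithLp.toLp 2 v‖ ^ 2 = v ⬝ᵥ v := by
  rw [EuclideanSpace.norm_sq_eq]
  simp [dotProduct, sq]

theorem specNorm_le_iff {Y : Matrix (Fin m) (Fin n) ℝ} {T : ℝ} (hT : 0 ≤ T) :
    specNorm Y ≤ T ↔ ∀ v, (Y *ᵥ v) ⬝ᵥ (Y *ᵥ v) ≤ T ^ 2 * (v ⬝ᵥ v) := by
  have h : specNorm Y ≤ T ↔ ∀ v : EuclideanSpace ℝ (Fin n),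
      ‖WithLp.toLp 2 (Y *ᵥ v.ofLp)‖ ≤ T * ‖v‖ :=
    ContinuousLinearMap.opNorm_le_iff
      (f := (toEuclideanLin (𝕜 := ℝ)).trans LinearMap.toContinuousLinearMap Y) hT
  rw [h]
  have key : ∀ v : Fin n → ℝ, ‖WithLp.toLp 2 (Y *ᵥ v)‖ ≤ T * ‖WithLp.toLp 2 v‖ ↔
      (Y *ᵥ v) ⬝ᵥ (Y *ᵥ v) ≤ T ^ 2 * (v ⬝ᵥ v) := fun v => by
    rw [← norm_toLp_sq, ← norm_toLp_sq, ← mul_pow]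
    exact (sq_le_sq₀ (norm_nonneg _) (by positivity)).symm
  exact ⟨fun H v => (key v).1 (H (WithLp.toLp 2 v)), fun H v => (key v.ofLp).2 (H v.ofLp)⟩

theorem single_mulVec_dotProduct_self (i : Fin m) (j : Fin n) (r : ℝ) (v : Fin n → ℝ) :
    Matrix.single i j r *ᵥ v ⬝ᵥ Matrix.single i j r *ᵥ v = r ^ 2 * (v j * v j) := by
  have h : Matrix.single i j r *ᵥ v = Pi.single i (r * v j) := single_mulVec i j r v
  rw [h, dotProduct_single, Pi.single_eq_same]
  ring

theorem specNorm_single_le (i : Fin m) (j : Fin n) (r : ℝ) :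
    specNorm (Matrix.single i j r) ≤ |r| := by
  rw [specNorm_le_iff (abs_nonneg r)]
  intro v
  rw [single_mulVec_dotProduct_self, sq_abs]
  have : v j * v j ≤ v ⬝ᵥ v :=
    Finset.single_le_sum (f := fun j => v j * v j) (fun j _ => mul_self_nonneg _)
      (Finset.mem_univ j)
  gcongr

theorem specNorm_le_frobNorm (Y : Matrix (Fin m) (Fin n) ℝ) : specNorm Y ≤ frobNorm Y := by
  have h0 : 0 ≤ frobNorm Y := by
    open scoped Matrix.Norms.Frobenius in exact norm_nonneg Y
  rw [specNorm_le_iff h0, frobNorm_sq]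
  intro v
  rw [Finset.sum_mul]
  refine Finset.sum_le_sum fun i _ => ?_
  have := Finset.sum_mul_sq_le_sq_mul_sq Finset.univ (Y i) v
  simpa [dotProduct, mulVec, sq] using this

theorem posSemidef_smul_one_sub_dilation_iff {Y : Matrix (Fin m) (Fin n) ℝ} {T : ℝ} (hT : 0 < T) :
    (T • 1 - dilation Y).PosSemidef ↔ specNorm Y ≤ T := by
  have hform : ∀ u w, Sum.elim u w ⬝ᵥ ((T • 1 - dilation Y) *ᵥ Sum.elim u w) =
      T * (u ⬝ᵥ u) + T * (w ⬝ᵥ w) - 2 * (u ⬝ᵥ Y *ᵥ w) := fun u w => by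
    rw [sub_mulVec, dotProduct_sub, dotProduct_dilation_mulVec, smul_mulVec, one_mulVec,
      dotProduct_smul, sumElim_dotProduct_sumElim, smul_eq_mul, mul_add]
  rw [specNorm_le_iff hT.le]
  constructor
  · intro h w
    -- For fixed `w`, the quadratic form is smallest at `u = T⁻¹ • Y w`.
    have h1 := h.dotProduct_mulVec_nonneg (Sum.elim (T⁻¹ • (Y *ᵥ w)) w)
    rw [star_trivial, hform] at h1
    simp only [smul_dotProduct, dotProduct_smul, smul_eq_mul] at h1
    have h2 : T * (T * (T⁻¹ * (T⁻¹ * (Y *ᵥ w ⬝ᵥ Y *ᵥ w))) + T * (w ⬝ᵥ w) -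
        2 * (T⁻¹ * (Y *ᵥ w ⬝ᵥ Y *ᵥ w))) = T ^ 2 * (w ⬝ᵥ w) - Y *ᵥ w ⬝ᵥ Y *ᵥ w := by
      field_simp; ring
    have h3 := mul_nonneg hT.le h1
    rw [h2] at h3
    linarith
  · intro h
    refine .of_dotProduct_mulVec_nonneg ?_ fun x => ?_
    · exact (isSymm_one.smul T).sub (dilation_isSymm Y)
    · obtain ⟨u, w, rfl⟩ : ∃ u w, x = Sum.elim u w := ⟨_, _, (Sum.elim_comp_inl_inr x).symm⟩
      rw [star_trivial, hform]
      have h1 : 0 ≤ (T • u - Y *ᵥ w) ⬝ᵥ (T • u - Y *ᵥ w) :=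
        Finset.sum_nonneg fun i _ => mul_self_nonneg _
      have h2 : (T • u - Y *ᵥ w) ⬝ᵥ (T • u - Y *ᵥ w) =
          T ^ 2 * (u ⬝ᵥ u) - 2 * T * (u ⬝ᵥ Y *ᵥ w) + Y *ᵥ w ⬝ᵥ Y *ᵥ w := by
        simp only [sub_dotProduct, dotProduct_sub, smul_dotProduct, dotProduct_smul, smul_eq_mul,
          dotProduct_comm (Y *ᵥ w) u]
        ring
      have h3 := h w
      refine nonneg_of_mul_nonneg_right (a := T) ?_ hT
      nlinarith

open Classical in
/-- The **matrix Bernstein inequality** for the spectral norm of a sum of `s` independent copies of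
a centred random rectangular matrix `Y`; the hypotheses `hcol` and `hrow` say `E (Yᵀ * Y) ≤ v • 1` and
`E (Y * Yᵀ) ≤ v • 1`. -/
theorem matrixBernstein {α : Type*} [Fintype α] {p : α → ℝ} (hp : ∀ a, 0 ≤ p a) (hp1 : ∑ a, p a = 1)
    {Y : α → Matrix (Fin m) (Fin n) ℝ} (hmean : ∑ a, p a • Y a = 0)
    {L v T : ℝ} (hL : 0 < L) (hv : 0 < v) (hT : 0 < T) (hYL : ∀ a, specNorm (Y a) ≤ L)
    (hcol : ∀ w, ∑ a, p a * (Y a *ᵥ w ⬝ᵥ Y a *ᵥ w) ≤ v * (w ⬝ᵥ w))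
    (hrow : ∀ u, ∑ a, p a * ((Y a)ᵀ *ᵥ u ⬝ᵥ (Y a)ᵀ *ᵥ u) ≤ v * (u ⬝ᵥ u))
    {s : ℕ} (hs : 0 < s) :
    ∑ pos : Fin s → α with ¬ specNorm (∑ t, Y (pos t)) ≤ s * T, ∏ t, p (pos t) ≤
      (m + n) * Real.exp (-(s * (T ^ 2 / (2 * (v + L * T / 3))))) := by
  have hsT : 0 < s * T := mul_pos (Nat.cast_pos.2 hs) hT
  have hvar : (v • 1 - ∑ a, p a • (dilation (Y a) * dilation (Y a))).PosSemidef := by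
    refine .of_dotProduct_mulVec_nonneg ?_ fun x => ?_
    · refine (isSymm_one.smul v).sub (isSymm_sum _ fun a => IsSymm.smul ?_ _)
      rw [← sq]; exact (dilation_isSymm _).pow 2
    · obtain ⟨u, w, rfl⟩ : ∃ u w, x = Sum.elim u w := ⟨_, _, (Sum.elim_comp_inl_inr x).symm⟩
      have h1 : ∀ a, Sum.elim u w ⬝ᵥ ((dilation (Y a) * dilation (Y a)) *ᵥ Sum.elim u w) =
          Y a *ᵥ w ⬝ᵥ Y a *ᵥ w + (Y a)ᵀ *ᵥ u ⬝ᵥ (Y a)ᵀ *ᵥ u := fun a => by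
        rw [← mulVec_mulVec, dotProduct_mulVec, ← mulVec_transpose, (dilation_isSymm (Y a)).eq,
          dilation_mulVec, sumElim_dotProduct_sumElim]
      rw [star_trivial, sub_mulVec, dotProduct_sub, smul_mulVec, one_mulVec, dotProduct_smul,
        sumElim_dotProduct_sumElim, sum_mulVec, dotProduct_sum]
      simp only [smul_mulVec, dotProduct_smul, h1, smul_eq_mul, mul_add, Finset.sum_add_distrib]
      linarith [hcol w, hrow u]
  have h := matrixBernstein_symm hp hp1 (fun a => dilation_isSymm (Y a))
    (by simp only [← map_smul, ← map_sum, hmean, map_zero]) hL.le hv hT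
    (fun a => (posSemidef_smul_one_sub_dilation_iff hL).2 (hYL a)) hvar s
  simp only [← map_sum, posSemidef_smul_one_sub_dilation_iff hsT] at h
  simpa using h

end Rectangular

/-! ### Moments of independent samples -/

section Sampling

open Classical in
/-- Probabilities of events that depend on the sampled positions only are finite sums of product
weights. -/
theorem IsIIDSample.measureReal_setOf {Ω : Type*} [MeasurableSpace Ω] {μ : Measure Ω}
    [IsProbabilityMeasure μ] {m n s : ℕ} {p : Fin m → Fin n → ℝ} {idx : Fin s → Ω → Fin m × Fin n}
    (h : IsIIDSample μ p idx) (Q : (Fin s → Fin m × Fin n) → Prop) :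
    μ.real {ω | Q fun t => idx t ω} =
      ∑ pos : Fin s → Fin m × Fin n with Q pos, ∏ t, p (pos t).1 (pos t).2 := by
  have hmeas : Measurable fun ω t => idx t ω := measurable_pi_lambda _ h.measurable
  have hatom : ∀ pos : Fin s → Fin m × Fin n,
      μ.real ((fun ω t => idx t ω) ⁻¹' {pos}) = ∏ t, p (pos t).1 (pos t).2 := fun pos => by
    have h1 : (fun ω t => idx t ω) ⁻¹' {pos} = ⋂ t ∈ Finset.univ, idx t ⁻¹' {pos t} := by
      ext ω; simp [funext_iff]
    rw [h1, measureReal_def, h.indep.measure_inter_preimage_eq_mul Finset.univ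
      (fun t _ => measurableSet_singleton _), ENNReal.toReal_prod]
    exact Finset.prod_congr rfl fun t _ => h.law t _ _
  have h2 : {ω | Q fun t => idx t ω} = (fun ω t => idx t ω) ⁻¹'
      ((Finset.univ.filter Q : Finset (Fin s → Fin m × Fin n)) : Set (Fin s → Fin m × Fin n)) := by
    ext ω; simp
  rw [h2, ← sum_measureReal_preimage_singleton _ fun y _ => hmeas (measurableSet_singleton y)]
  exact Finset.sum_congr rfl fun pos _ => hatom pos

variable {m n : ℕ}

/-- Centring a random matrix does not increase its second moments. -/
theorem sum_mul_sub_mulVec_le {α : Type*} [Fintype α] {p : α → ℝ} (hp1 : ∑ a, p a = 1)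
    {X : Matrix (Fin m) (Fin n) ℝ} {R : α → Matrix (Fin m) (Fin n) ℝ}
    (hmean : ∑ a, p a • R a = X) (v : Fin n → ℝ) :
    ∑ a, p a * ((X - R a) *ᵥ v ⬝ᵥ (X - R a) *ᵥ v) ≤ ∑ a, p a * (R a *ᵥ v ⬝ᵥ R a *ᵥ v) := by
  have h1 : ∑ a, p a * (X *ᵥ v ⬝ᵥ R a *ᵥ v) = X *ᵥ v ⬝ᵥ X *ᵥ v := by
    have : X *ᵥ v = ∑ a, p a • (R a *ᵥ v) := by
      rw [← hmean, sum_mulVec]; simp only [smul_mulVec]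
    conv_rhs => rw [this, dotProduct_sum, ← this]
    simp only [dotProduct_smul, smul_eq_mul]
  have h2 : ∑ a, p a * ((X - R a) *ᵥ v ⬝ᵥ (X - R a) *ᵥ v) =
      ∑ a, p a * (R a *ᵥ v ⬝ᵥ R a *ᵥ v) - X *ᵥ v ⬝ᵥ X *ᵥ v := by
    have h3 : ∀ a, p a * ((X - R a) *ᵥ v ⬝ᵥ (X - R a) *ᵥ v) = p a * (R a *ᵥ v ⬝ᵥ R a *ᵥ v) -
        2 * (p a * (X *ᵥ v ⬝ᵥ R a *ᵥ v)) + p a * (X *ᵥ v ⬝ᵥ X *ᵥ v) := fun a => by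
      simp only [sub_mulVec, sub_dotProduct, dotProduct_sub, dotProduct_comm (R a *ᵥ v) (X *ᵥ v)]
      ring
    simp only [h3, Finset.sum_add_distrib, Finset.sum_sub_distrib, ← Finset.mul_sum, h1,
      ← Finset.sum_mul, hp1]
    ring
  have h4 : 0 ≤ X *ᵥ v ⬝ᵥ X *ᵥ v := Finset.sum_nonneg fun i _ => mul_self_nonneg _
  linarith

theorem sum_mul_single_mulVec_le {p r : Fin m → Fin n → ℝ} {C : ℝ}
    (hC : ∀ i j, p i j * r i j ^ 2 ≤ C) (v : Fin n → ℝ) :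
    ∑ i, ∑ j, p i j * (Matrix.single i j (r i j) *ᵥ v ⬝ᵥ Matrix.single i j (r i j) *ᵥ v) ≤
      m * C * (v ⬝ᵥ v) := by
  have h : ∀ i j, p i j * (Matrix.single i j (r i j) *ᵥ v ⬝ᵥ Matrix.single i j (r i j) *ᵥ v) ≤
      C * (v j * v j) := fun i j => by
    rw [single_mulVec_dotProduct_self]
    have := mul_le_mul_of_nonneg_right (hC i j) (mul_self_nonneg (v j))
    linarith
  calc _ ≤ ∑ i : Fin m, ∑ j, C * (v j * v j) :=
        Finset.sum_le_sum fun i _ => Finset.sum_le_sum fun j _ => h i j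
    _ = m * C * (v ⬝ᵥ v) := by simp [← Finset.mul_sum, dotProduct, mul_assoc]

theorem sum_abs_le_max_mul_frobNorm (X : Matrix (Fin m) (Fin n) ℝ) :
    ∑ k, ∑ l, |X k l| ≤ (max m n : ℝ) * frobNorm X := by
  have h0 : 0 ≤ frobNorm X := by
    open scoped Matrix.Norms.Frobenius in exact norm_nonneg X
  have h1 : (∑ k, ∑ l, |X k l|) ^ 2 ≤ (m * n : ℝ) * frobNorm X ^ 2 := by
    rw [frobNorm_sq, ← Fintype.sum_prod_type', ← Fintype.sum_prod_type']
    have := sq_sum_le_card_mul_sum_sq (s := (Finset.univ : Finset (Fin m × Fin n)))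
      (f := fun x => |X x.1 x.2|)
    simpa using this
  refine abs_le_of_sq_le_sq' (h1.trans ?_) (by positivity) |>.2
  rw [mul_pow, sq (max (m : ℝ) n)]
  gcongr
  · exact le_max_left _ _
  · exact le_max_right _ _

end Sampling

/-! ### The sampling operator -/

section Estimates
variable {m n : ℕ}

theorem SatisfiesBound.sq_le {X : Matrix (Fin m) (Fin n) ℝ} {β : ℝ} {p : Fin m → Fin n → ℝ}
    (h : SatisfiesBound X β p) (hβ : 0 < β) (hF : 0 < frobNorm X) (i : Fin m) (j : Fin n) :
    X i j ^ 2 ≤ 2 * frobNorm X ^ 2 / β * p i j := by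
  have h1 : 0 ≤ |X i j| / ∑ k, ∑ l, |X k l| := by positivity
  have h2 : X i j ^ 2 / frobNorm X ^ 2 ≤ 2 / β * p i j := by
    rw [div_mul_eq_mul_div, le_div_iff₀ hβ]
    nlinarith [h i j]
  rw [div_le_iff₀ (by positivity)] at h2
  calc _ ≤ _ := h2
    _ = _ := by ring

theorem SatisfiesBound.abs_le {X : Matrix (Fin m) (Fin n) ℝ} {β : ℝ} {p : Fin m → Fin n → ℝ}
    (h : SatisfiesBound X β p) (hβ : 0 < β) (i : Fin m) (j : Fin n) :
    |X i j| ≤ 2 * (∑ k, ∑ l, |X k l|) / β * p i j := by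
  have hle : |X i j| ≤ ∑ k, ∑ l, |X k l| :=
    (Finset.single_le_sum (f := fun l => |X i l|) (fun l _ => abs_nonneg _)
      (Finset.mem_univ j)).trans
    (Finset.single_le_sum (f := fun k => ∑ l, |X k l|)
      (fun k _ => Finset.sum_nonneg fun l _ => abs_nonneg _) (Finset.mem_univ i))
  have h1 : 0 ≤ X i j ^ 2 / frobNorm X ^ 2 := by positivity
  have h2 : |X i j| / ∑ k, ∑ l, |X k l| ≤ 2 / β * p i j := by
    rw [div_mul_eq_mul_div, le_div_iff₀ hβ]
    nlinarith [h i j]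
  rcases ((abs_nonneg _).trans hle).eq_or_lt with h0 | h0
  · rw [← h0] at hle ⊢
    simpa using hle
  · rw [div_le_iff₀ h0] at h2
    calc _ ≤ _ := h2
      _ = _ := by ring

/-- The contribution of one sampled position `a` to the sketch of `X`, before averaging. It is `0`
when `p a = 0`, by the convention for division by zero. -/
noncomputable def draw (p : Fin m → Fin n → ℝ) (X : Matrix (Fin m) (Fin n) ℝ)
    (a : Fin m × Fin n) : Matrix (Fin m) (Fin n) ℝ :=
  Matrix.single a.1 a.2 (X a.1 a.2 / p a.1 a.2)

/-- A draw is an unbiased estimator of `X`, provided that no nonzero entry has probability `0`. -/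
theorem sum_smul_draw {p : Fin m → Fin n → ℝ} {X : Matrix (Fin m) (Fin n) ℝ}
    (h : ∀ i j, p i j = 0 → X i j = 0) : ∑ a : Fin m × Fin n, p a.1 a.2 • draw p X a = X := by
  conv_rhs => rw [matrix_eq_sum_single X]
  rw [Fintype.sum_prod_type]
  refine Finset.sum_congr rfl fun i _ => Finset.sum_congr rfl fun j _ => ?_
  rw [draw, smul_single, smul_eq_mul]
  congr 1
  by_cases hp : p i j = 0
  · simp [hp, h i j hp]
  · exact mul_div_cancel₀ _ hp

theorem specNorm_sub_sketch {s : ℕ} (hs : 0 < s) (p : Fin m → Fin n → ℝ)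
    (pos : Fin s → Fin m × Fin n) (X : Matrix (Fin m) (Fin n) ℝ) :
    specNorm (X - sketch p pos X) = (s : ℝ)⁻¹ * specNorm (∑ t, (X - draw p X (pos t))) := by
  have hs' : (s : ℝ) ≠ 0 := by exact_mod_cast hs.ne'
  have h : X - sketch p pos X = (s : ℝ)⁻¹ • ∑ t, (X - draw p X (pos t)) := by
    rw [Finset.sum_sub_distrib, smul_sub, Finset.sum_const, Finset.card_univ, Fintype.card_fin,
      ← Nat.cast_smul_eq_nsmul ℝ, smul_smul, inv_mul_cancel₀ hs', one_smul, sketch, one_div]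
    rfl
  rw [h, specNorm_smul, abs_of_nonneg (by positivity)]

theorem sum_mul_sub_draw_mulVec_le {p : Fin m → Fin n → ℝ} {X : Matrix (Fin m) (Fin n) ℝ} {C : ℝ}
    (hp1 : ∑ a : Fin m × Fin n, p a.1 a.2 = 1) (h : ∀ i j, p i j = 0 → X i j = 0)
    (hC : ∀ i j, p i j * (X i j / p i j) ^ 2 ≤ C) (w : Fin n → ℝ) :
    ∑ a : Fin m × Fin n, p a.1 a.2 * ((X - draw p X a) *ᵥ w ⬝ᵥ (X - draw p X a) *ᵥ w) ≤
      m * C * (w ⬝ᵥ w) := by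
  refine (sum_mul_sub_mulVec_le hp1 (sum_smul_draw h) w).trans ?_
  rw [Fintype.sum_prod_type]
  exact sum_mul_single_mulVec_le hC w

/-- The row version of `sum_mul_sub_draw_mulVec_le`, obtained from it by transposing everything. -/
theorem sum_mul_transpose_sub_draw_mulVec_le {p : Fin m → Fin n → ℝ}
    {X : Matrix (Fin m) (Fin n) ℝ} {C : ℝ}
    (hp1 : ∑ a : Fin m × Fin n, p a.1 a.2 = 1) (h : ∀ i j, p i j = 0 → X i j = 0)
    (hC : ∀ i j, p i j * (X i j / p i j) ^ 2 ≤ C) (u : Fin m → ℝ) :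
    ∑ a : Fin m × Fin n, p a.1 a.2 * ((X - draw p X a)ᵀ *ᵥ u ⬝ᵥ (X - draw p X a)ᵀ *ᵥ u) ≤
      n * C * (u ⬝ᵥ u) := by
  have h1 := sum_mul_sub_draw_mulVec_le (p := fun j i => p i j) (X := Xᵀ) (C := C)
    (by rw [← hp1, ← (Equiv.prodComm _ _).sum_comp]; rfl) (fun j i => h i j) (fun j i => hC i j) u
  rw [← (Equiv.prodComm _ _).sum_comp] at h1
  refine le_trans (le_of_eq (Finset.sum_congr rfl fun a _ => ?_)) h1
  have h2 : (X - draw p X a)ᵀ = Xᵀ - draw (fun j i => p i j) Xᵀ (Equiv.prodComm _ _ a) := by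
    simp [draw, transpose_sub]
  rw [h2]
  rfl

open Classical in
/-- The failure probability, from `matrixBernstein` with `v = 2 M ‖X‖_F ^ 2 / β`,
`L = 2 M ‖X‖_F / β + ‖X‖₂` and `T = ε ‖X‖₂`, where `M = max m n`. -/
theorem sum_prod_not_specNorm_le {s : ℕ} (hs : 0 < s) {X : Matrix (Fin m) (Fin n) ℝ}
    {ε β : ℝ} (hε : 0 < ε) (hβ0 : 0 < β) (hβ1 : β ≤ 1) (hF : 0 < frobNorm X)
    (hN : 0 < specNorm X) (hεF : ε * specNorm X ≤ frobNorm X) (hM : 1 ≤ max (m : ℝ) n)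
    {p : Fin m → Fin n → ℝ} (hp : IsProbDistribution p) (hbound : SatisfiesBound X β p) :
    ∑ pos : Fin s → Fin m × Fin n with
        ¬ specNorm (X - sketch p pos X) ≤ ε * specNorm X, ∏ t, p (pos t).1 (pos t).2 ≤
      (m + n) * Real.exp
        (-(s * (β * (ε * specNorm X) ^ 2 / (6 * max (m : ℝ) n * frobNorm X ^ 2)))) := by
  have hp1 : ∑ a : Fin m × Fin n, p a.1 a.2 = 1 := by rw [Fintype.sum_prod_type, hp.sum_eq_one]
  set M : ℝ := max (m : ℝ) n
  set F := frobNorm X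
  set N := specNorm X
  set C := 2 * F ^ 2 / β with hC
  have hC0 : 0 < C := by positivity
  have hM0 : 0 < M := zero_lt_one.trans_le hM
  have hsq := hbound.sq_le hβ0 hF
  have hzero : ∀ i j, p i j = 0 → X i j = 0 := fun i j h0 => by
    have := hsq i j
    rw [h0, mul_zero] at this
    exact pow_eq_zero_iff two_ne_zero |>.1 (le_antisymm this (sq_nonneg _))
  have hCp : ∀ i j, p i j * (X i j / p i j) ^ 2 ≤ C := fun i j => by
    rcases (hp.nonneg i j).eq_or_lt with h0 | h0
    · rw [← h0, zero_mul]; exact hC0.le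
    · calc p i j * (X i j / p i j) ^ 2 = X i j ^ 2 / p i j := by field_simp
        _ ≤ C := (div_le_iff₀ h0).2 (hsq i j)
  set L := 2 * (M * F) / β + N with hL
  have hdraw : ∀ a, specNorm (X - draw p X a) ≤ L := fun a => by
    have h1 : |X a.1 a.2 / p a.1 a.2| ≤ 2 * (M * F) / β := by
      refine le_trans ?_ (show 2 * (∑ k, ∑ l, |X k l|) / β ≤ _ by
        gcongr; exact sum_abs_le_max_mul_frobNorm X)
      rcases (hp.nonneg a.1 a.2).eq_or_lt with h0 | h0
      · rw [← h0, div_zero, abs_zero]; positivity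
      · rw [abs_div, abs_of_pos h0, div_le_iff₀ h0]
        exact hbound.abs_le hβ0 _ _
    calc _ ≤ N + specNorm (draw p X a) := specNorm_sub_le _ _
      _ ≤ N + 2 * (M * F) / β := by gcongr; exact (specNorm_single_le _ _ _).trans h1
      _ = L := add_comm _ _
  have hself : ∀ {k : ℕ} (v : Fin k → ℝ), 0 ≤ v ⬝ᵥ v := fun v =>
    Finset.sum_nonneg fun i _ => mul_self_nonneg _
  have hB := matrixBernstein (p := fun a : Fin m × Fin n => p a.1 a.2) (fun a => hp.nonneg _ _) hp1
    (Y := fun a => X - draw p X a)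
    (by simp only [smul_sub, Finset.sum_sub_distrib, sum_smul_draw hzero, ← Finset.sum_smul, hp1,
          one_smul, sub_self])
    (L := L) (v := M * C) (T := ε * N) (by positivity) (by positivity) (by positivity) hdraw
    (fun w => (sum_mul_sub_draw_mulVec_le hp1 hzero hCp w).trans <| by
      have := hself w
      gcongr; exact le_max_left _ _)
    (fun u => (sum_mul_transpose_sub_draw_mulVec_le hp1 hzero hCp u).trans <| by
      have := hself u
      gcongr; exact le_max_right _ _) hs
  have hiff : ∀ pos : Fin s → Fin m × Fin n, specNorm (∑ t, (X - draw p X (pos t))) ≤ s * (ε * N) ↔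
      specNorm (X - sketch p pos X) ≤ ε * N := fun pos => by
    rw [specNorm_sub_sketch hs, inv_mul_le_iff₀ (Nat.cast_pos.2 hs)]
  simp only [hiff] at hB
  refine hB.trans ?_
  -- `L * (ε * N) ≤ 3 * M * F ^ 2 / β`, because `ε * N ≤ F`, `N ≤ F` and `1 ≤ M / β`.
  have hden : M * C + L * (ε * N) / 3 ≤ 3 * M * F ^ 2 / β := by
    have h1 : N * (ε * N) ≤ M * F ^ 2 / β := by
      have h2 : F ^ 2 ≤ M * F ^ 2 / β := by
        rw [le_div_iff₀ hβ0]
        rw [mul_comm]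
        gcongr
        exact hβ1.trans hM
      calc N * (ε * N) ≤ F * F := by gcongr; exact specNorm_le_frobNorm X
        _ ≤ _ := by rw [← sq]; exact h2
    have h3 : 2 * (M * F) / β * (ε * N) ≤ 2 * (M * F) / β * F := by gcongr
    have h4 : L * (ε * N) ≤ 3 * M * F ^ 2 / β := by
      rw [hL, add_mul]
      calc _ ≤ 2 * (M * F) / β * F + M * F ^ 2 / β := add_le_add h3 h1
        _ = _ := by ring
    have h5 : M * C = 2 * (M * F ^ 2 / β) := by rw [hC]; ring
    have h6 : 3 * M * F ^ 2 / β = 3 * (M * F ^ 2 / β) := by ring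
    rw [h6] at h4 ⊢
    linarith
  have hL0 : 0 < L := by positivity
  gcongr _ * Real.exp (-(_ * ?_))
  calc β * (ε * N) ^ 2 / (6 * M * F ^ 2) = (ε * N) ^ 2 / (2 * (3 * M * F ^ 2 / β)) := by
        field_simp; ring
    _ ≤ _ := by gcongr

end Estimates

end ElementSampling

theorem mainTheorem2 {m n s : ℕ} (hs : 0 < s) (X : Matrix (Fin m) (Fin n) ℝ)
    (ε β δ : ℝ) (hε : 0 < ε) (hβ0 : 0 < β) (hβ1 : β ≤ 1) (hδ : 0 < δ)
    (hsr : ε ^ 2 ≤ ElementSampling.stableRank X)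
    (p : Fin m → Fin n → ℝ) (hp : ElementSampling.IsProbDistribution p)
    (hbound : ElementSampling.SatisfiesBound X β p)
    (hsize : 6 * (max m n : ℝ) * Real.log (((m : ℝ) + n) / δ) / (β * ε ^ 2) *
      ElementSampling.stableRank X ≤ (s : ℝ))
    {Ω : Type*} [MeasurableSpace Ω] (μ : Measure Ω) [IsProbabilityMeasure μ]
    (idx : Fin s → Ω → Fin m × Fin n) (hidx : ElementSampling.IsIIDSample μ p idx) :
    1 - δ ≤ μ.real {ω | ElementSampling.specNorm
      (X - ElementSampling.sketch p (fun t => idx t ω) X) ≤ ε * ElementSampling.specNorm X} := by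
  classical
  open ElementSampling in
  have hpos : 0 < stableRank X := (pow_pos hε 2).trans_le hsr
  have hF0 : 0 ≤ frobNorm X := by
    open scoped Matrix.Norms.Frobenius in exact norm_nonneg X
  have hN : 0 < specNorm X := by
    refine (specNorm_nonneg X).lt_of_ne fun h => ?_
    simp [stableRank, ← h] at hpos
  have hF : 0 < frobNorm X := by
    refine hF0.lt_of_ne fun h => ?_
    simp [stableRank, ← h] at hpos
  have hm : 0 < m := by
    rcases Nat.eq_zero_or_pos m with rfl | h
    · have := frobNorm_sq X
      simp [hF.ne'] at this
    · exact h
  have hM : (1 : ℝ) ≤ max (m : ℝ) n := le_max_of_le_left (by exact_mod_cast hm)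
  have hεF : ε * specNorm X ≤ frobNorm X := by
    rw [stableRank, le_div_iff₀ (by positivity), ← mul_pow] at hsr
    exact (sq_le_sq₀ (by positivity) hF0).1 hsr
  have hlog : Real.log (((m : ℝ) + n) / δ) ≤
      s * (β * (ε * specNorm X) ^ 2 / (6 * max (m : ℝ) n * frobNorm X ^ 2)) := by
    have hM0 : 0 < max (m : ℝ) n := zero_lt_one.trans_le hM
    rw [stableRank] at hsize
    calc _ = 6 * max (m : ℝ) n * Real.log (((m : ℝ) + n) / δ) / (β * ε ^ 2) *
          (frobNorm X ^ 2 / specNorm X ^ 2) *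
          (β * (ε * specNorm X) ^ 2 / (6 * max (m : ℝ) n * frobNorm X ^ 2)) := by field_simp
      _ ≤ _ := by gcongr
  have hbad := sum_prod_not_specNorm_le hs hε hβ0 hβ1 hF hN hεF hM hp hbound
  have hmn : 0 < (m : ℝ) + n := by positivity
  have hδ' : ((m : ℝ) + n) * Real.exp
      (-(s * (β * (ε * specNorm X) ^ 2 / (6 * max (m : ℝ) n * frobNorm X ^ 2)))) ≤ δ := by
    calc _ ≤ ((m : ℝ) + n) * Real.exp (-Real.log (((m : ℝ) + n) / δ)) := by gcongr
      _ = δ := by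
        rw [Real.exp_neg, Real.exp_log (by positivity)]; field_simp
  -- With the event `True`, the total weight of all samples is `1`.
  have htotal := hidx.measureReal_setOf fun _ => True
  have hgood := hidx.measureReal_setOf fun pos => specNorm (X - sketch p pos X) ≤ ε * specNorm X
  rw [hgood]
  have hsplit := Finset.sum_filter_add_sum_filter_not Finset.univ
    (fun pos : Fin s → Fin m × Fin n => specNorm (X - sketch p pos X) ≤ ε * specNorm X)
    (fun pos => ∏ t, p (pos t).1 (pos t).2)
  simp only [Set.ofPred_true, probReal_univ, Finset.filter_true] at htotal
  linarith
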